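/- Let $F$ be a number field, regarded as a subfield of $\mathbb{C}$ through any embedding. Let $p\neq q$ be primes, let $m,n\ge 0$ and $r$ be integers such that the multiplicative order of $r$ modulo $q^m$ is $p^n$, and let $G=\langle a\rangle_{q^m}\rtimes_1\langle b\rangle_{p^n}$, that is, $G$ is a group of order $q^mp^n$ generated by elements $a,b$ with $a^{q^m}=1$, $b^{p^n}=a^t$ for some integer $t$ (for instance $b^{p^n}=1$), and $b^{-1}ab=a^r$. For $k\ge1$ put $\zeta_k=e^{2\pi i/k}$. The number of simple components (minimal nonzero two-sided ideals) of the group algebra $FG$ is called minimal if it equals the number of simple components of $\mathbb{Q}G$. Let $\mathbb{Q}(\zeta_{q^m})^{\langle b\rangle}$ be the subfield of $\mathbb{Q}(\zeta_{q^m})$ fixed by the action of $\langle b\rangle$ given by $b\cdot\zeta_{q^m}=\zeta_{q^m}^{\,r}$. Let $I_k(F)\le(\mathbb{Z}/k\mathbb{Z})^\times$ be the image of $\mathrm{Gal}(F(\zeta_k)/F)$ under the map sending $\sigma$ to the class of $s$ with $\sigma(\zeta_k)=\zeta_k^{\,s}$. Then the number of simple components of $FG$ is minimal if and only if $$\mathbb{Q}(\zeta_{p^n})\cap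 F=\mathbb{Q}\quad\text{and}\quad \mathbb{Q}(\zeta_{q^m})^{\langle b\rangle}\cap F=\mathbb{Q}.$$ Moreover, the condition $\mathbb{Q}(\zeta_{p^n})\cap F=\mathbb{Q}$ is equivalent to $|I_{p^n}(F)|=\varphi(p^n)$ (which is $p^{n-1}(p-1)$ when $n\ge1$), where $\varphi$ is Euler's function. -/

import Mathlib

open scoped IntermediateField

/-- The group `G`, with elements `a` and `b`, is the metacyclic group
`⟨a, b | a ^ M = 1, b ^ N = a ^ t, b⁻¹ a b = a ^ r⟩` of order `M * N` (for some integer `t`):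
`⟨a⟩` is a cyclic normal subgroup of order `M`, and the quotient `G / ⟨a⟩` is cyclic of
order `N`, generated by the class of `b`. The split case is the case `b ^ N = 1`. -/
structure IsMetacyclic (G : Type*) [Group G] (M N : ℕ) (r : ℤ) (a b : G) : Prop where
  a_pow : a ^ M = 1
  b_pow : ∃ t : ℤ, b ^ N = a ^ t
  conj : b⁻¹ * a * b = a ^ r
  generate : Subgroup.closure {a, b} = ⊤
  card : Nat.card G = M * N

/-- The number of simple components of a semisimple ring `A`: the simple components are the
minimal nonzero two-sided ideals of `A`. -/
noncomputable def numSimpleComponents (A : Type*) [Ring A] : ℕ :=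
  Nat.card {I : TwoSidedIdeal A // IsAtom I}

/-- The number of simple components of the group algebra `F G` is minimal: it is equal to the
number of simple components of the rational group algebra `ℚ G`. -/
def HasMinimalNumSimpleComponents (F G : Type*) [Field F] [Group G] : Prop :=
  numSimpleComponents (MonoidAlgebra F G) = numSimpleComponents (MonoidAlgebra ℚ G)

/-- The complex primitive `k`-th root of unity `ζ_k = exp (2πi / k)`. -/
noncomputable def cZeta (k : ℕ) : ℂ := Complex.exp (2 * Real.pi * Complex.I / k)

theorem isPrimitiveRoot_cZeta (k : ℕ) [NeZero k] : IsPrimitiveRoot (cZeta k) k :=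
  Complex.isPrimitiveRoot_exp k (NeZero.ne k)

/-- The subgroup of `Gal(ℚ(ζ_k)/ℚ)` generated by the automorphism with `ζ_k ↦ ζ_k ^ r`. For `r`
coprime to `k` there is exactly one such automorphism, see `existsUnique_cyclotomicAut`. -/
noncomputable def cyclotomicPowSubgroup (k : ℕ) (r : ℤ) :
    Subgroup (ℚ⟮cZeta k⟯ ≃ₐ[ℚ] ℚ⟮cZeta k⟯) :=
  Subgroup.closure {τ | τ (IntermediateField.AdjoinSimple.gen ℚ (cZeta k)) =
    IntermediateField.AdjoinSimple.gen ℚ (cZeta k) ^ r}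

/-- The subfield of `ℚ(ζ_k)`, as a subfield of `ℂ`, fixed by the automorphism with
`ζ_k ↦ ζ_k ^ r` (and so by the group that it generates). -/
noncomputable def cyclotomicFixedField (k : ℕ) (r : ℤ) : IntermediateField ℚ ℂ :=
  IntermediateField.lift (IntermediateField.fixedField (cyclotomicPowSubgroup k r))

/-- The group `I_k(F)`: the image of `Gal(F(ζ_k)/F)` in the unit group of `ℤ/kℤ` under the map
sending `σ` to the class `t` with `σ ζ_k = ζ_k ^ t`. -/
noncomputable def cyclotomicImage (k : ℕ) [NeZero k] (F : Type*) [Field F] [NumberField F] :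
    Subgroup (ZMod k)ˣ :=
  ((IsCyclotomicExtension.zeta_spec k F (CyclotomicField k F)).autToPow F).range

theorem existsUnique_cyclotomicAut (k : ℕ) [NeZero k] (r : ℤ) (hr : IsUnit (r : ZMod k)) :
    ∃! τ : ℚ⟮cZeta k⟯ ≃ₐ[ℚ] ℚ⟮cZeta k⟯,
      τ (IntermediateField.AdjoinSimple.gen ℚ (cZeta k)) =
        IntermediateField.AdjoinSimple.gen ℚ (cZeta k) ^ r := by
  set L := ℚ⟮cZeta k⟯
  set g : L := IntermediateField.AdjoinSimple.gen ℚ (cZeta k)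
  have hz := isPrimitiveRoot_cZeta k
  have hg : IsPrimitiveRoot g k := by
    rw [← IsPrimitiveRoot.coe_submonoidClass_iff]
    exact hz
  have hint : IsIntegral ℚ (cZeta k) := (hz.isIntegral (NeZero.pos k)).tower_top
  have hL : IsCyclotomicExtension {k} ℚ L := by
    change IsCyclotomicExtension {k} ℚ (IntermediateField.adjoin ℚ {cZeta k}).toSubalgebra
    rw [IntermediateField.adjoin_simple_toSubalgebra_of_isAlgebraic hint.isAlgebraic]
    exact hz.adjoin_isCyclotomicExtension ℚ
  obtain ⟨u, hu⟩ := hr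
  have hirr := Polynomial.cyclotomic.irreducible_rat (NeZero.pos k)
  have hpow : g ^ (u : ZMod k).val = g ^ r := by
    have h1 : g ^ (((u : ZMod k).val : ℤ) - r) = 1 := by
      rw [hg.zpow_eq_one_iff_dvd, ← ZMod.intCast_zmod_eq_zero_iff_dvd]
      simp [hu]
    rw [zpow_sub₀ (hg.ne_zero (NeZero.ne k)), zpow_natCast] at h1
    exact eq_of_div_eq_one h1
  refine ⟨(IsCyclotomicExtension.autEquivPow L hirr).symm u, ?_, ?_⟩
  · have hsp := IsCyclotomicExtension.zeta_spec k ℚ L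
    have h2 := hsp.autToPow_spec ℚ ((IsCyclotomicExtension.autEquivPow L hirr).symm u)
    have h3 : hsp.autToPow ℚ ((IsCyclotomicExtension.autEquivPow L hirr).symm u) = u :=
      (IsCyclotomicExtension.autEquivPow L hirr).apply_symm_apply u
    obtain ⟨i, -, hi⟩ := hsp.eq_pow_of_pow_eq_one hg.pow_eq_one
    beta_reduce
    rw [← hpow, ← hi, map_pow, ← h2, h3, ← pow_mul, ← pow_mul, mul_comm]
  · intro τ hτ
    have hsub : ∀ τ₁ τ₂ : L ≃ₐ[ℚ] L, τ₁ g = τ₂ g → τ₁ = τ₂ := by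
      intro τ₁ τ₂ h12
      apply AlgEquiv.coe_toAlgHom_injective
      apply (hg.powerBasis ℚ).algHom_ext
      simpa using h12
    have hsp := IsCyclotomicExtension.zeta_spec k ℚ L
    have h2 := hsp.autToPow_spec ℚ ((IsCyclotomicExtension.autEquivPow L hirr).symm u)
    have h3 : hsp.autToPow ℚ ((IsCyclotomicExtension.autEquivPow L hirr).symm u) = u :=
      (IsCyclotomicExtension.autEquivPow L hirr).apply_symm_apply u
    obtain ⟨i, -, hi⟩ := hsp.eq_pow_of_pow_eq_one hg.pow_eq_one
    apply hsub
    rw [hτ, ← hpow, ← hi, map_pow, ← h2, h3, ← pow_mul, ← pow_mul, mul_comm]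

/-!
The two-sided ideals of a semisimple ring are generated by unique central idempotents and form a
finite Boolean algebra, so a ring with `s` simple components has `2 ^ s` central idempotents
(`card_centralIdempotents`). As `ℚ G` embeds in `F G`, the number of simple components of `F G` is
minimal exactly when every central idempotent of `F G` has rational coefficients. Inside `ℂ G` the
central idempotents of `F G` are the idempotents whose coefficients form a class function with
values in the image of `F` (`hasMinimalNumSimpleComponents_iff_complex`).

For a cyclic group of order `k`, the discrete Fourier transform shows that the idempotents over `ℂ`
are the elements with coefficients `k⁻¹ * ∑ j ∈ S, ζ_k ^ (j i)` for a set `S` of exponents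
(`mul_self_eq_iff_exists_finset`). This controls `G` through its two cyclic layers.

* Sufficiency (`IsMetacyclic.coeff_rational`). Let `e` be an idempotent class function with values
  in `F`. Its sums over the cosets of `⟨a⟩` are coefficients of an idempotent of `ℂ[G ⧸ ⟨a⟩]`,
  hence lie in `ℚ(ζ_{p^n}) ∩ F`. As `r` has order `p ^ n` modulo `q ^ m` and `p ≠ q`, the number
  `1 - r ^ j` is a unit modulo `q ^ m` unless `p ^ n ∣ j`; so a coset of `⟨a⟩` other than `⟨a⟩`
  lies in one conjugacy class, and `e` is constant on it. Subtracting from `e` its average over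
  cosets therefore leaves an idempotent of `ℂ[⟨a⟩]`; being invariant under conjugation by `b`,
  its coefficients lie in `ℚ(ζ_{q^m})^⟨b⟩ ∩ F`.
* Necessity (`IsMetacyclic.adjoin_inf_eq_bot`, `IsMetacyclic.cyclotomicFixedField_inf_eq_bot`).
  For a subfield `E` of `ℚ(ζ_k)`, the relative traces of the powers of `ζ_k` are sums
  `∑ j ∈ S, ζ_k ^ (j i)` that span `E` over `ℚ` (`exists_finset_sum_stdAddChar`). With `E` the
  intersection in question, they are, up to a rational factor, the coefficients of a central
  idempotent of `F G`, inflated from `G ⧸ ⟨a⟩` or supported on `⟨a⟩`. If it is rational,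
  then `E = ℚ`.

Finally `|I_k(F)|` is the degree of `F(ζ_k)` over `F`, and since `ℚ(ζ_k)` is Galois over `ℚ`, that
degree is `φ(k)` exactly when `ℚ(ζ_k) ∩ F = ℚ` (`adjoin_cZeta_inf_eq_bot_iff`).
-/

/-! ### Central idempotents of semisimple rings -/

/-- The two-sided ideals of a semisimple ring are the sums of isotypic components of its left
regular module, so they form the Boolean algebra of all sets of isotypic components. -/
noncomputable def twoSidedIdealOrderIso (A : Type*) [Ring A] [IsSemisimpleRing A] :
    TwoSidedIdeal A ≃o Set (isotypicComponents A A) :=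
  TwoSidedIdeal.orderIsoIsTwoSided.trans <|
    OrderIso.trans
      { toFun := fun I => ⟨I.1, isFullyInvariant_iff_isTwoSided.2 I.2⟩
        invFun := fun I => ⟨I.1, isFullyInvariant_iff_isTwoSided.1 I.2⟩
        left_inv := fun _ => rfl
        right_inv := fun _ => rfl
        map_rel_iff' := Iff.rfl }
      (OrderIso.setIsotypicComponents (R := A) (M := A)).symm

instance TwoSidedIdeal.instFiniteOfIsSemisimpleRing (A : Type*) [Ring A] [IsSemisimpleRing A] :
    Finite (TwoSidedIdeal A) :=
  Finite.of_equiv _ (twoSidedIdealOrderIso A).toEquiv.symm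

theorem card_twoSidedIdeal_eq_two_pow (A : Type*) [Ring A] [IsSemisimpleRing A] :
    Nat.card (TwoSidedIdeal A) = 2 ^ numSimpleComponents A := by
  have key : numSimpleComponents A = Nat.card (isotypicComponents A A) := by
    have e1 : {I : TwoSidedIdeal A // IsAtom I} ≃ {s : Set (isotypicComponents A A) // IsAtom s} :=
      (twoSidedIdealOrderIso A).toEquiv.subtypeEquiv
        fun I => ((twoSidedIdealOrderIso A).isAtom_iff I).symm
    have e2 : isotypicComponents A A ≃ {s : Set (isotypicComponents A A) // IsAtom s} :=
      Equiv.ofBijective (fun c => ⟨{c}, Set.isAtom_singleton c⟩)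
        ⟨fun c d h => by simpa using h, fun ⟨s, hs⟩ => by
          obtain ⟨c, rfl⟩ := Set.isAtom_iff.1 hs
          exact ⟨c, rfl⟩⟩
    exact Nat.card_congr (e1.trans e2.symm)
  rw [key, Nat.card_congr (twoSidedIdealOrderIso A).toEquiv]
  classical
  have := Fintype.ofFinite (isotypicComponents A A)
  simp [Nat.card_eq_fintype_card]

/-- The set of central idempotents of a ring, including `0` and `1`. -/
def centralIdempotents (A : Type*) [Ring A] : Set A := {e | e * e = e ∧ e ∈ Set.center A}

theorem mem_span_singleton_iff_of_mem_centralIdempotents {A : Type*} [Ring A] {e : A}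
    (he : e ∈ centralIdempotents A) (x : A) : x ∈ TwoSidedIdeal.span {e} ↔ e * x = x := by
  have hc : ∀ y, e * y = y * e := fun y => (he.2.comm y)
  constructor
  · intro hx
    let J : TwoSidedIdeal A := TwoSidedIdeal.mk' {y | e * y = y} (by simp)
      (by intro x y hx hy; simp only [Set.mem_ofPred_eq] at *; rw [mul_add, hx, hy])
      (by intro x hx; simp only [Set.mem_ofPred_eq] at *; rw [mul_neg, hx])
      (by
        intro x y hy; simp only [Set.mem_ofPred_eq] at *
        rw [← mul_assoc, hc x, mul_assoc, hy])
      (by intro x y hx; simp only [Set.mem_ofPred_eq] at *; rw [← mul_assoc, hx])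
    have hle : TwoSidedIdeal.span {e} ≤ J := by
      rw [TwoSidedIdeal.span_le]
      rintro _ rfl
      simpa [J, TwoSidedIdeal.mem_mk'] using he.1
    simpa [J, TwoSidedIdeal.mem_mk'] using hle hx
  · intro hx
    rw [← hx]
    exact TwoSidedIdeal.mul_mem_right _ _ _ (TwoSidedIdeal.subset_span rfl)

/-- In a semisimple ring every two-sided ideal is generated by a unique central idempotent. -/
theorem span_singleton_bijective_centralIdempotents (A : Type*) [Ring A] [IsSemisimpleRing A] :
    Function.Bijective fun e : centralIdempotents A => TwoSidedIdeal.span {(e : A)} := by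
  constructor
  · rintro ⟨e, he⟩ ⟨f, hf⟩ h
    have h' : TwoSidedIdeal.span {e} = TwoSidedIdeal.span {f} := h
    have h1 : f * e = e := (mem_span_singleton_iff_of_mem_centralIdempotents hf e).1
      (h' ▸ TwoSidedIdeal.subset_span rfl)
    have h2 : e * f = f := (mem_span_singleton_iff_of_mem_centralIdempotents he f).1
      (h'.symm ▸ TwoSidedIdeal.subset_span rfl)
    exact Subtype.ext (h1.symm.trans ((he.2.comm f).symm.trans h2))
  · intro I
    -- the generator is the component in `I` of `1`, for the decomposition `A = I ⊕ J`
    let J := (twoSidedIdealOrderIso A).symm (twoSidedIdealOrderIso A I)ᶜ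
    have hinf : I ⊓ J = ⊥ := by
      apply (twoSidedIdealOrderIso A).injective
      simp only [J, OrderIso.map_inf, OrderIso.map_bot, OrderIso.apply_symm_apply, inf_compl_eq_bot]
    have hsup : I ⊔ J = ⊤ := by
      apply (twoSidedIdealOrderIso A).injective
      simp only [J, OrderIso.map_sup, OrderIso.map_top, OrderIso.apply_symm_apply, sup_compl_eq_top]
    obtain ⟨e, he, f, hf, hef⟩ := TwoSidedIdeal.mem_sup.1
      (show (1 : A) ∈ I ⊔ J from hsup ▸ TwoSidedIdeal.mem_top A)
    have h0 : ∀ z, z ∈ I → z ∈ J → z = 0 := fun z h1 h2 => by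
      have : z ∈ I ⊓ J := (TwoSidedIdeal.mem_inf A).2 ⟨h1, h2⟩
      rwa [hinf, TwoSidedIdeal.mem_bot] at this
    have hl : ∀ x ∈ I, e * x = x := fun x hx => by
      have : f * x = 0 := h0 _ (I.mul_mem_left _ _ hx) (J.mul_mem_right _ _ hf)
      calc e * x = (e + f) * x := by rw [add_mul, this, add_zero]
        _ = x := by rw [hef, one_mul]
    have hr : ∀ x ∈ I, x * e = x := fun x hx => by
      have : x * f = 0 := h0 _ (I.mul_mem_right _ _ hx) (J.mul_mem_left _ _ hf)
      calc x * e = x * (e + f) := by rw [mul_add, this, add_zero]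
        _ = x := by rw [hef, mul_one]
    have hc : e ∈ centralIdempotents A := by
      refine ⟨hl e he, ?_⟩
      rw [Semigroup.mem_center_iff]
      intro g
      rw [← hl (g * e) (I.mul_mem_left _ _ he), ← mul_assoc, hr (e * g) (I.mul_mem_right _ _ he)]
    refine ⟨⟨e, hc⟩, TwoSidedIdeal.ext fun x => ?_⟩
    rw [mem_span_singleton_iff_of_mem_centralIdempotents hc]
    exact ⟨fun h => h ▸ I.mul_mem_right _ _ he, hl x⟩

theorem card_centralIdempotents (A : Type*) [Ring A] [IsSemisimpleRing A] :
    Nat.card (centralIdempotents A) = 2 ^ numSimpleComponents A := by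
  rw [← card_twoSidedIdeal_eq_two_pow]
  exact Nat.card_congr (Equiv.ofBijective _ (span_singleton_bijective_centralIdempotents A))

/-- Minimal two-sided ideals are counted by central idempotents, so enlarging a semisimple ring
keeps their number exactly when it creates no new central idempotent. -/
theorem numSimpleComponents_eq_iff {A B : Type*} [Ring A] [Ring B] [IsSemisimpleRing A]
    [IsSemisimpleRing B] (f : A →+* B) (hf : Function.Injective f)
    (hc : ∀ x ∈ Set.center A, f x ∈ Set.center B) :
    numSimpleComponents B = numSimpleComponents A ↔ ∀ e ∈ centralIdempotents B, e ∈ f.range := by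
  have hcen : ∀ x, f x ∈ Set.center B → x ∈ Set.center A := fun x hx => by
    rw [Semigroup.mem_center_iff]
    intro g
    exact hf (by rw [map_mul, map_mul, hx.comm])
  let φ : centralIdempotents A → centralIdempotents B :=
    fun e => ⟨f e, by rw [← map_mul, e.2.1], hc _ e.2.2⟩
  have hφ : Function.Injective φ := fun e e' h => Subtype.ext (hf (congrArg Subtype.val h))
  have hfB : Finite (centralIdempotents B) :=
    Finite.of_injective _ (span_singleton_bijective_centralIdempotents B).1
  have hsurj : Function.Surjective φ ↔ ∀ e ∈ centralIdempotents B, e ∈ f.range := by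
    constructor
    · intro h e he
      obtain ⟨x, hx⟩ := h ⟨e, he⟩
      exact ⟨x, congrArg Subtype.val hx⟩
    · rintro h ⟨e, he⟩
      obtain ⟨x, rfl⟩ := h e he
      exact ⟨⟨x, hf (by rw [map_mul, he.1]), hcen _ he.2⟩, rfl⟩
  rw [← hsurj, ← Nat.pow_right_injective le_rfl |>.eq_iff (a := numSimpleComponents B),
    ← card_centralIdempotents, ← card_centralIdempotents]
  constructor
  · intro h
    exact ((Nat.bijective_iff_injective_and_card φ).2 ⟨hφ, h.symm⟩).2
  · intro h
    exact (Nat.card_congr (Equiv.ofBijective φ ⟨hφ, h⟩)).symm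

/-! ### Central idempotents of group algebras -/

namespace MonoidAlgebra

theorem coeff_mul_eq_sum {R G : Type*} [CommRing R] [Group G] [Fintype G]
    (x y : MonoidAlgebra R G) (g : G) :
    (x * y).coeff g = ∑ h, x.coeff h * y.coeff (h⁻¹ * g) := by
  classical
  rw [coeff_mul, Finsupp.sum_fintype _ _ (by simp)]
  refine Finset.sum_congr rfl fun h _ => ?_
  rw [Finsupp.sum_fintype _ _ (by simp), Finset.sum_eq_single (h⁻¹ * g)]
  · simp
  · intro b _ hb
    rw [if_neg]
    rintro rfl
    simp at hb
  · simp

theorem coeff_of_mul {R G : Type*} [CommRing R] [Group G] [Finite G]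
    (x : MonoidAlgebra R G) (h g : G) : (of R G h * x).coeff g = x.coeff (h⁻¹ * g) := by
  classical
  have := Fintype.ofFinite G
  rw [coeff_mul_eq_sum, Finset.sum_eq_single h] <;> simp +contextual [eq_comm]

theorem coeff_mul_of {R G : Type*} [CommRing R] [Group G] [Finite G]
    (x : MonoidAlgebra R G) (h g : G) : (x * of R G h).coeff g = x.coeff (g * h⁻¹) := by
  classical
  have := Fintype.ofFinite G
  rw [coeff_mul_eq_sum, Finset.sum_eq_single (g * h⁻¹)]
  · simp
  · intro b _ hb
    rw [of_apply, coeff_single, Finsupp.single_apply, if_neg, mul_zero]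
    rintro rfl
    simp at hb
  · simp

/-- An element of a group algebra is central if and only if its coefficients form a class
function. -/
theorem mem_center_iff_coeff_conj {R G : Type*} [CommRing R] [Group G] [Finite G]
    {x : MonoidAlgebra R G} :
    x ∈ Set.center (MonoidAlgebra R G) ↔ ∀ h g : G, x.coeff (h⁻¹ * g * h) = x.coeff g := by
  constructor
  · intro hx h g
    have := congrArg (fun y => y.coeff (g * h)) (hx.comm (of R G h)).eq
    simp only [coeff_of_mul, coeff_mul_of] at this
    simpa [mul_assoc] using this.symm
  · intro hx
    rw [Semigroup.mem_center_iff]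
    intro y
    have hof : ∀ h : G, of R G h * x = x * of R G h := fun h => by
      refine coeff_injective (Finsupp.ext fun g => ?_)
      rw [coeff_of_mul, coeff_mul_of, ← hx h (g * h⁻¹)]
      simp [mul_assoc]
    induction y using MonoidAlgebra.induction_on with
    | of h => exact hof h
    | add y z hy hz => rw [add_mul, mul_add, hy, hz]
    | smul r y hy => rw [smul_mul_assoc, mul_smul_comm, hy]

end MonoidAlgebra

open MonoidAlgebra in
/-- The number of simple components is minimal exactly when every central idempotent over the
large field already has rational coefficients. -/
theorem hasMinimalNumSimpleComponents_iff (F G : Type*) [Field F] [CharZero F] [Group G]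
    [Finite G] :
    HasMinimalNumSimpleComponents F G ↔
      ∀ e ∈ centralIdempotents (MonoidAlgebra F G), ∀ g, ∃ c : ℚ, (c : F) = e.coeff g := by
  have h1 : NeZero (Nat.card G : ℚ) := ⟨by exact_mod_cast Nat.card_pos.ne'⟩
  have h2 : NeZero (Nat.card G : F) := ⟨by exact_mod_cast Nat.card_pos.ne'⟩
  have hinj : Function.Injective (mapRingHom G (algebraMap ℚ F)) :=
    map_injective _ (algebraMap ℚ F).injective
  refine (numSimpleComponents_eq_iff (mapRingHom G (algebraMap ℚ F)) hinj ?_).trans ?_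
  · intro x hx
    rw [mem_center_iff_coeff_conj] at hx ⊢
    intro h g
    simp [hx h g]
  · refine forall₂_congr fun e _ => ?_
    have := Set.ext_iff.1 (range_map (M := G) (algebraMap ℚ F : ℚ →+ F)) e
    refine Iff.trans this ?_
    simp [Set.mem_range]

/-! ### Idempotents in the group algebra of a cyclic group -/

section Fourier

open ZMod MonoidAlgebra

/-- The discrete Fourier transform of the coefficients is evaluation at characters, so it turns the
convolution product into the pointwise product. -/
theorem lift_stdAddChar_eq_dft (k : ℕ) [NeZero k]
    (x : MonoidAlgebra ℂ (Multiplicative (ZMod k))) (j : ZMod k) :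
    MonoidAlgebra.lift ℂ ℂ _ ((stdAddChar (N := k)).mulShift (-j)).toMonoidHom x =
      ZMod.dft (fun i => x.coeff (Multiplicative.ofAdd i)) j := by
  rw [lift_apply, Finsupp.sum_fintype _ _ (by simp), dft_apply]
  refine Fintype.sum_equiv Multiplicative.toAdd _ _ fun i => ?_
  simp [mul_comm, AddChar.mulShift_apply]

theorem isIdempotentElem_iff_dft {k : ℕ} [NeZero k]
    (x : MonoidAlgebra ℂ (Multiplicative (ZMod k))) :
    x * x = x ↔ ∀ j, ZMod.dft (fun i => x.coeff (Multiplicative.ofAdd i)) j = 0 ∨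
      ZMod.dft (fun i => x.coeff (Multiplicative.ofAdd i)) j = 1 := by
  have hx : x * x = x ↔ ∀ j, ZMod.dft (fun i => (x * x).coeff (Multiplicative.ofAdd i)) j =
      ZMod.dft (fun i => x.coeff (Multiplicative.ofAdd i)) j := by
    rw [← funext_iff, (ZMod.dft (N := k) (E := ℂ)).injective.eq_iff, funext_iff]
    constructor
    · intro h i
      rw [h]
    · intro h
      exact coeff_injective (Finsupp.ext h)
  rw [hx]
  refine forall_congr' fun j => ?_
  simp only [← lift_stdAddChar_eq_dft, map_mul]
  exact IsIdempotentElem.iff_eq_zero_or_one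

/-- Idempotents of the complex group algebra of a cyclic group are sums of characters. -/
theorem mul_self_eq_iff_exists_finset {k : ℕ} [NeZero k]
    (x : MonoidAlgebra ℂ (Multiplicative (ZMod k))) :
    x * x = x ↔ ∃ S : Finset (ZMod k), ∀ i : ZMod k,
      x.coeff (Multiplicative.ofAdd i) = (k : ℂ)⁻¹ * ∑ j ∈ S, stdAddChar (j * i) := by
  classical
  rw [isIdempotentElem_iff_dft]
  set f : ZMod k → ℂ := fun i => x.coeff (Multiplicative.ofAdd i) with hf
  constructor
  · intro h
    refine ⟨Finset.univ.filter fun j => ZMod.dft f j = 1, fun i => ?_⟩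
    have h1 : f i = (ZMod.dft (N := k) (E := ℂ)).symm (ZMod.dft f) i := by simp
    change f i = _
    rw [h1, invDFT_apply, smul_eq_mul, Finset.sum_filter]
    congr 1
    refine Finset.sum_congr rfl fun j _ => ?_
    rcases h j with h | h <;> simp [h]
  · rintro ⟨S, hS⟩ j
    have h1 : f = (ZMod.dft (N := k) (E := ℂ)).symm fun j => if j ∈ S then 1 else 0 := by
      funext i
      rw [invDFT_apply]
      simp [hf, hS]
    rw [h1, LinearEquiv.apply_symm_apply]
    by_cases h : j ∈ S <;> simp [h]

end Fourier

/-! ### Character sums in cyclotomic fields -/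

section CharacterSums

open ZMod

theorem stdAddChar_intCast_eq_cZeta_zpow (k : ℕ) [NeZero k] (n : ℤ) :
    stdAddChar (n : ZMod k) = cZeta k ^ n := by
  rw [stdAddChar_coe, cZeta, ← Complex.exp_int_mul]
  congr 1
  ring

theorem stdAddChar_eq_cZeta_pow (k : ℕ) [NeZero k] (i : ZMod k) :
    stdAddChar i = cZeta k ^ i.val := by
  have := stdAddChar_intCast_eq_cZeta_zpow k (i.val : ℤ)
  rwa [zpow_natCast, Int.cast_natCast, ZMod.natCast_zmod_val] at this

section Cyclotomic

variable {L : Type*} [Field L] [Algebra ℚ L] {k : ℕ} [NeZero k] {g : L} (v : L →ₐ[ℚ] ℂ)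

theorem isPrimitiveRoot_of_map_eq_cZeta (hg : v g = cZeta k) : IsPrimitiveRoot g k :=
  IsPrimitiveRoot.of_map_of_injective (f := v) (hg ▸ isPrimitiveRoot_cZeta k) v.injective

theorem map_pow_val_eq_stdAddChar (hg : v g = cZeta k) (i : ZMod k) :
    v (g ^ i.val) = stdAddChar i := by
  rw [map_pow, hg, stdAddChar_eq_cZeta_pow]

theorem map_algEquiv_pow_val (hg : v g = cZeta k) {r : ℤ} {τ : L ≃ₐ[ℚ] L} (hτ : τ g = g ^ r)
    (i : ZMod k) : v (τ (g ^ i.val)) = stdAddChar ((r : ZMod k) * i) := by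
  have := stdAddChar_intCast_eq_cZeta_zpow k (r * i.val)
  rw [map_pow, hτ, map_pow, map_zpow₀, hg, ← zpow_natCast, ← zpow_mul, ← this]
  simp

variable [IsCyclotomicExtension {k} ℚ L]

/-- An automorphism of `ℚ(ζ_k)` is determined by the exponent by which it acts on `ζ_k`. -/
theorem exists_exponent_injective (hg : v g = cZeta k) :
    ∃ c : (L ≃ₐ[ℚ] L) → ZMod k, Function.Injective c ∧
      ∀ σ i, v (σ (g ^ i.val)) = stdAddChar (c σ * i) := by
  have hp := isPrimitiveRoot_of_map_eq_cZeta v hg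
  refine ⟨fun σ => (hp.autToPow ℚ σ : (ZMod k)ˣ),
    Units.val_injective.comp (hp.autToPow_injective ℚ), fun σ i => ?_⟩
  have h := hp.autToPow_spec ℚ σ
  rw [map_algEquiv_pow_val v hg (r := ((hp.autToPow ℚ σ : (ZMod k)ˣ) : ZMod k).val)]
  · simp
  · rw [zpow_natCast, h]

theorem span_range_pow_val (hg : v g = cZeta k) :
    Submodule.span ℚ (Set.range fun i : ZMod k => g ^ i.val) = ⊤ := by
  have hp := isPrimitiveRoot_of_map_eq_cZeta v hg
  rw [eq_top_iff, ← (hp.powerBasis ℚ).basis.span_eq, Submodule.span_le]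
  rintro _ ⟨i, rfl⟩
  refine Submodule.subset_span ⟨((i : ℕ) : ZMod k), ?_⟩
  rw [PowerBasis.basis_eq_pow, IsPrimitiveRoot.powerBasis_gen]
  simp only [ZMod.val_natCast]
  conv_rhs => rw [← Nat.mod_add_div (i : ℕ) k, pow_add, pow_mul, hp.pow_eq_one, one_pow, mul_one]

/-- Every subfield `E` of `ℚ(ζ_k)` is detected by one family of character sums: the traces
`∑ σ, σ (ζ ^ i)` over the automorphisms `σ` of `ℚ(ζ_k)` that fix `E`. They lie in `E`; they
span it over `ℚ`, so that `E = ℚ` if all of them are rational; and they are invariant under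
`i ↦ r i` if the automorphism `ζ ↦ ζ ^ r` fixes `E`. -/
theorem exists_finset_sum_stdAddChar_of_map (hg : v g = cZeta k) (E : IntermediateField ℚ L) :
    ∃ S : Finset (ZMod k), (∀ i, ∃ x ∈ E, v x = ∑ j ∈ S, stdAddChar (j * i)) ∧
      ((∀ i, ∑ j ∈ S, stdAddChar (j * i) ∈ (⊥ : IntermediateField ℚ ℂ)) →
        ∀ x ∈ E, v x ∈ (⊥ : IntermediateField ℚ ℂ)) ∧
      ∀ (r : ℤ) (τ : L ≃ₐ[ℚ] L), τ g = g ^ r → (∀ x ∈ E, τ x = x) →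
        ∀ i, ∑ j ∈ S, stdAddChar (j * ((r : ZMod k) * i)) = ∑ j ∈ S, stdAddChar (j * i) := by
  classical
  have hfd : FiniteDimensional ℚ L := IsCyclotomicExtension.finiteDimensional {k} ℚ L
  have hgal : IsGalois ℚ L := IsCyclotomicExtension.isGalois {k} ℚ L
  obtain ⟨c, hc, hcv⟩ := exists_exponent_injective v hg
  set H := E.fixingSubgroup with hH
  have hsum : ∀ i, ∑ j ∈ Finset.univ.image fun σ : H => c σ, stdAddChar (j * i) =
      v (∑ σ : H, (σ : L ≃ₐ[ℚ] L) (g ^ i.val)) := fun i => by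
    rw [Finset.sum_image fun σ _ τ _ h => Subtype.ext (hc h), map_sum]
    simp only [hcv]
  refine ⟨Finset.univ.image fun σ : H => c σ, ?_, ?_, ?_⟩
  · intro i
    refine ⟨_, ?_, (hsum i).symm⟩
    rw [← IsGalois.fixedField_fixingSubgroup E, IntermediateField.mem_fixedField_iff]
    intro τ hτ
    rw [map_sum]
    exact Fintype.sum_equiv (Equiv.mulLeft (⟨τ, hτ⟩ : H)) _ _ fun σ => rfl
  · intro h
    have hT : ∀ y : L, v (∑ σ : H, (σ : L ≃ₐ[ℚ] L) y) ∈ (⊥ : IntermediateField ℚ ℂ) := fun y => by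
      have hy : y ∈ Submodule.span ℚ (Set.range fun i : ZMod k => g ^ i.val) := by
        rw [span_range_pow_val v hg]; trivial
      induction hy using Submodule.span_induction with
      | mem y hy =>
        obtain ⟨i, rfl⟩ := hy
        rw [← hsum]
        exact h i
      | zero => simp
      | add y z _ _ hy hz =>
        simp only [map_add, Finset.sum_add_distrib]
        exact add_mem hy hz
      | smul c y _ hy =>
        simp only [Algebra.smul_def, map_mul, AlgEquiv.commutes, ← Finset.mul_sum,
          AlgHom.commutes]
        exact mul_mem (IntermediateField.algebraMap_mem _ c) hy
    -- on `E` the trace is multiplication by the order of the fixing subgroup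
    intro y hy
    have h1 := hT y
    have h2 : ∀ σ : H, (σ : L ≃ₐ[ℚ] L) y = y := fun σ =>
      (IntermediateField.mem_fixingSubgroup_iff E σ.1).1 σ.2 y hy
    simp only [h2, Finset.sum_const, Finset.card_univ, map_nsmul] at h1
    have h3 : (Fintype.card H : ℂ) ≠ 0 := by exact_mod_cast Fintype.card_ne_zero
    have h4 : v y = (Fintype.card H : ℂ)⁻¹ * (Fintype.card H • v y) := by
      rw [nsmul_eq_mul, inv_mul_cancel_left₀ h3]
    rw [h4]
    exact mul_mem (inv_mem (natCast_mem _ _)) h1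
  · intro r τ hτ hEτ i
    have hτH : τ ∈ H := (IntermediateField.mem_fixingSubgroup_iff E τ).2 hEτ
    have hpow : g ^ ((r : ZMod k) * i).val = τ (g ^ i.val) := v.injective <| by
      change v _ = v _
      rw [map_algEquiv_pow_val v hg hτ, map_pow_val_eq_stdAddChar v hg]
    rw [hsum, hsum, hpow]
    congr 1
    exact Fintype.sum_equiv (Equiv.mulRight (⟨τ, hτH⟩ : H)) _ _ fun σ => rfl

end Cyclotomic

theorem isCyclotomicExtension_adjoin_simple {F₀ E : Type*} [Field F₀] [Field E] [Algebra F₀ E]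
    {k : ℕ} [NeZero k] {ζ : E} (hζ : IsPrimitiveRoot ζ k) :
    IsCyclotomicExtension {k} F₀ F₀⟮ζ⟯ := by
  have hint : IsIntegral F₀ ζ := (hζ.isIntegral (NeZero.pos k)).tower_top
  change IsCyclotomicExtension {k} F₀ (IntermediateField.adjoin F₀ {ζ}).toSubalgebra
  rw [IntermediateField.adjoin_simple_toSubalgebra_of_isAlgebraic hint.isAlgebraic]
  exact hζ.adjoin_isCyclotomicExtension F₀

theorem isCyclotomicExtension_adjoin_cZeta (k : ℕ) [NeZero k] :
    IsCyclotomicExtension {k} ℚ ℚ⟮cZeta k⟯ :=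
  isCyclotomicExtension_adjoin_simple (isPrimitiveRoot_cZeta k)

theorem stdAddChar_mem_adjoin_cZeta (k : ℕ) [NeZero k] (i : ZMod k) :
    stdAddChar i ∈ ℚ⟮cZeta k⟯ := by
  rw [stdAddChar_eq_cZeta_pow]
  exact pow_mem (IntermediateField.mem_adjoin_simple_self ℚ _) _

theorem mem_cyclotomicFixedField_iff {k : ℕ} {r : ℤ} (x : ℚ⟮cZeta k⟯) :
    (x : ℂ) ∈ cyclotomicFixedField k r ↔ ∀ τ : ℚ⟮cZeta k⟯ ≃ₐ[ℚ] ℚ⟮cZeta k⟯,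
      τ (IntermediateField.AdjoinSimple.gen ℚ (cZeta k)) =
        IntermediateField.AdjoinSimple.gen ℚ (cZeta k) ^ r → τ x = x := by
  have h : (x : ℂ) ∈ cyclotomicFixedField k r ↔ ∀ σ : cyclotomicPowSubgroup k r,
      (σ : ℚ⟮cZeta k⟯ ≃ₐ[ℚ] ℚ⟮cZeta k⟯) x = x := by
    rw [cyclotomicFixedField]
    exact IntermediateField.mem_lift x
  rw [h]
  constructor
  · exact fun h τ hτ => h ⟨τ, Subgroup.subset_closure hτ⟩
  · rintro h ⟨σ, hσ⟩
    change σ x = x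
    induction hσ using Subgroup.closure_induction with
    | mem τ hτ => exact h τ hτ
    | one => rfl
    | mul σ τ _ _ hσ hτ => rw [AlgEquiv.mul_apply, hτ, hσ]
    | inv σ _ hσ => exact σ.injective ((σ.apply_symm_apply x).trans hσ.symm)

theorem cyclotomicFixedField_le (k : ℕ) (r : ℤ) : cyclotomicFixedField k r ≤ ℚ⟮cZeta k⟯ :=
  IntermediateField.lift_le _

/-- The inclusion of `ℚ(ζ_k)` into `ℂ`, as a homomorphism for the `ℚ`-algebra structure that every
field of characteristic zero carries; `IntermediateField.val` uses the one induced from `ℂ`, which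
is not syntactically the same. -/
noncomputable def cyclotomicVal (k : ℕ) : ℚ⟮cZeta k⟯ →ₐ[ℚ] ℂ :=
  RingHom.toRatAlgHom (algebraMap ℚ⟮cZeta k⟯ ℂ)

theorem cyclotomicVal_gen (k : ℕ) :
    cyclotomicVal k (IntermediateField.AdjoinSimple.gen ℚ (cZeta k)) = cZeta k := rfl

/-- A sum of `k`-th roots of unity of the form `∑ j ∈ S, ζ ^ (j i)` that does not change under
`i ↦ r i` is fixed by `ζ ↦ ζ ^ r`. -/
theorem sum_stdAddChar_mem_cyclotomicFixedField {k : ℕ} [NeZero k] (r : ℤ) (S : Finset (ZMod k))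
    (i : ZMod k)
    (h : ∑ j ∈ S, stdAddChar (j * ((r : ZMod k) * i)) = ∑ j ∈ S, stdAddChar (j * i)) :
    ∑ j ∈ S, stdAddChar (j * i) ∈ cyclotomicFixedField k r := by
  set g := IntermediateField.AdjoinSimple.gen ℚ (cZeta k)
  have hx : ∑ j ∈ S, stdAddChar (j * i) = cyclotomicVal k (∑ j ∈ S, g ^ (j * i).val) := by
    rw [map_sum]
    simp only [map_pow_val_eq_stdAddChar _ (cyclotomicVal_gen k), g]
  rw [hx]
  refine (mem_cyclotomicFixedField_iff _).2 fun τ hτ => (cyclotomicVal k).injective ?_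
  change cyclotomicVal k _ = cyclotomicVal k _
  rw [← hx, ← h, map_sum, map_sum]
  simp only [map_algEquiv_pow_val _ (cyclotomicVal_gen k) hτ, g, mul_left_comm (r : ZMod k)]

/-- `exists_finset_sum_stdAddChar_of_map` for a subfield of `ℚ(ζ_k)` inside `ℂ`. -/
theorem exists_finset_sum_stdAddChar (k : ℕ) [NeZero k] (E : IntermediateField ℚ ℂ)
    (hE : E ≤ ℚ⟮cZeta k⟯) :
    ∃ S : Finset (ZMod k), (∀ i, ∑ j ∈ S, stdAddChar (j * i) ∈ E) ∧
      ((∀ i, ∑ j ∈ S, stdAddChar (j * i) ∈ (⊥ : IntermediateField ℚ ℂ)) → E = ⊥) ∧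
      ∀ r : ℤ, IsUnit (r : ZMod k) → E ≤ cyclotomicFixedField k r →
        ∀ i, ∑ j ∈ S, stdAddChar (j * ((r : ZMod k) * i)) = ∑ j ∈ S, stdAddChar (j * i) := by
  have := isCyclotomicExtension_adjoin_cZeta k
  obtain ⟨S, h1, h2, h3⟩ := exists_finset_sum_stdAddChar_of_map (cyclotomicVal k)
    (cyclotomicVal_gen k) (E.comap (cyclotomicVal k))
  refine ⟨S, fun i => ?_, fun h => eq_bot_iff.2 fun x hx => ?_, fun r hr hEr => ?_⟩
  · obtain ⟨x, hx, hxi⟩ := h1 i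
    rw [← hxi]
    exact hx
  · exact h2 h ⟨x, hE hx⟩ hx
  · obtain ⟨τ, hτ, -⟩ := existsUnique_cyclotomicAut k r hr
    exact h3 r τ hτ fun x hx => (mem_cyclotomicFixedField_iff x).1 (hEr hx) τ hτ

end CharacterSums

/-! ### Structure of metacyclic groups -/

section MetacyclicGroup

open Multiplicative (ofAdd toAdd)

section Metacyclic

variable {G : Type*} [Group G] {M N : ℕ} {r : ℤ} {a b : G}

theorem IsMetacyclic.zpowers_normal [NeZero M] (hG : IsMetacyclic G M N r a b) :
    (Subgroup.zpowers a).Normal := by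
  have hfin : Finite (Subgroup.zpowers a : Set G) :=
    (isOfFinOrder_iff_pow_eq_one.2 ⟨M, NeZero.pos M, hG.a_pow⟩).finite_zpowers
  rw [← Subgroup.normalizer_eq_top_iff, eq_top_iff, ← hG.generate, Subgroup.closure_le]
  rintro g (rfl | rfl)
  · exact Subgroup.le_normalizer (Subgroup.mem_zpowers g)
  · rw [SetLike.mem_coe, ← inv_mem_iff]
    refine Subgroup.mem_normalizer_fintype ?_
    rintro _ ⟨i, rfl⟩
    refine ⟨r * i, ?_⟩
    have := map_zpow (MulAut.conj g⁻¹) a i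
    simp only [MulAut.conj_apply, inv_inv] at this
    change a ^ (r * i) = g⁻¹ * a ^ i * g⁻¹⁻¹
    rw [inv_inv, zpow_mul, ← hG.conj, this]

/-- A metacyclic group is an extension of `ℤ/N` by `ℤ/M`, with `a` and `b` corresponding to the
generators of the two cyclic groups. -/
theorem IsMetacyclic.exists_exact [NeZero M] [NeZero N] (hG : IsMetacyclic G M N r a b) :
    ∃ (α : Multiplicative (ZMod M) →* G) (π : G →* Multiplicative (ZMod N)),
      Function.Injective α ∧ α (ofAdd 1) = a ∧ π b = ofAdd 1 ∧ ∀ g, π g = 1 ↔ g ∈ α.range := by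
  have hn := hG.zpowers_normal
  have hbot : ∀ x : G ⧸ Subgroup.zpowers a, x ∈ Subgroup.zpowers (b : G ⧸ Subgroup.zpowers a) := by
    have h : (Subgroup.zpowers (b : G ⧸ Subgroup.zpowers a)).comap
        (QuotientGroup.mk' (Subgroup.zpowers a)) = ⊤ := by
      rw [eq_top_iff, ← hG.generate, Subgroup.closure_le]
      rintro g (rfl | rfl)
      · have : (g : G ⧸ Subgroup.zpowers g) = 1 :=
          (QuotientGroup.eq_one_iff g).2 (Subgroup.mem_zpowers g)
        simp [this]
      · simp
    intro x
    obtain ⟨g, rfl⟩ := QuotientGroup.mk_surjective x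
    have : g ∈ (⊤ : Subgroup G) := trivial
    rwa [← h] at this
  have hbN : (b : G ⧸ Subgroup.zpowers a) ^ N = 1 := by
    obtain ⟨t, ht⟩ := hG.b_pow
    rw [← QuotientGroup.mk_pow, ht, QuotientGroup.eq_one_iff]
    exact ⟨t, rfl⟩
  have h1 : Nat.card (Subgroup.zpowers a) ≤ M := by
    rw [Nat.card_zpowers]
    exact orderOf_le_of_pow_eq_one (NeZero.pos M) hG.a_pow
  have h2 : Nat.card (G ⧸ Subgroup.zpowers a) ≤ N := by
    rw [← Subgroup.card_top, ← (Subgroup.eq_top_iff' _).2 hbot, Nat.card_zpowers]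
    exact orderOf_le_of_pow_eq_one (NeZero.pos N) hbN
  have h3 : Nat.card (G ⧸ Subgroup.zpowers a) * Nat.card (Subgroup.zpowers a) = N * M := by
    rw [← Subgroup.card_eq_card_quotient_mul_card_subgroup, hG.card, mul_comm]
  have hM := NeZero.pos M
  have hN := NeZero.pos N
  -- the two upper bounds multiply to the order of `G`, so both are attained
  have hA : Nat.card (Subgroup.zpowers a) = M := by
    refine le_antisymm h1 (Nat.le_of_mul_le_mul_left ?_ hN)
    rw [← h3]
    exact Nat.mul_le_mul_right _ h2
  have hQ : Nat.card (G ⧸ Subgroup.zpowers a) = N := by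
    rw [hA] at h3
    exact Nat.eq_of_mul_eq_mul_right hM h3
  have hgen : ∀ x : Subgroup.zpowers a,
      x ∈ Subgroup.zpowers (⟨a, Subgroup.mem_zpowers a⟩ : Subgroup.zpowers a) := by
    rintro ⟨_, i, rfl⟩
    exact ⟨i, Subtype.ext (by simp)⟩
  refine ⟨(Subgroup.zpowers a).subtype.comp (zmodMulEquivOfGenerator hgen hA).toMonoidHom,
    (zmodMulEquivOfGenerator hbot hQ).symm.toMonoidHom.comp (QuotientGroup.mk' _), ?_, ?_, ?_, ?_⟩
  · exact Subtype.val_injective.comp (zmodMulEquivOfGenerator hgen hA).injective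
  · simp
  · simp
  · intro g
    rw [MonoidHom.range_comp]
    simp [Subgroup.mem_zpowers_iff]

variable {α : Multiplicative (ZMod M) →* G} {π : G →* Multiplicative (ZMod N)}

theorem IsMetacyclic.conj_map (hG : IsMetacyclic G M N r a b) (hα : α (ofAdd 1) = a)
    (i : ZMod M) : b⁻¹ * α (ofAdd i) * b = α (ofAdd ((r : ZMod M) * i)) := by
  obtain ⟨i, rfl⟩ := ZMod.intCast_surjective i
  have h : ∀ j : ℤ, α (ofAdd (j : ZMod M)) = a ^ j := fun j => by
    rw [← hα, ← map_zpow, ← ofAdd_zsmul]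
    simp
  have := map_zpow (MulAut.conj b⁻¹) a i
  simp only [MulAut.conj_apply, inv_inv] at this
  rw [← Int.cast_mul, h, h, zpow_mul, ← hG.conj, this]

theorem IsMetacyclic.conj_pow_map (hG : IsMetacyclic G M N r a b) (hα : α (ofAdd 1) = a)
    (n : ℕ) (i : ZMod M) :
    (b ^ n)⁻¹ * α (ofAdd i) * b ^ n = α (ofAdd ((r : ZMod M) ^ n * i)) := by
  induction n with
  | zero => simp
  | succ n ih =>
    rw [pow_succ' (r : ZMod M), mul_assoc (r : ZMod M), ← hG.conj_map hα, ← ih, pow_succ]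
    group

/-- Conjugation on `⟨a⟩` depends only on the class modulo `⟨a⟩`, since `⟨a⟩` is abelian. -/
theorem IsMetacyclic.conj_map_of_map_eq [NeZero N] (hG : IsMetacyclic G M N r a b)
    (hα : α (ofAdd 1) = a) (hb : π b = ofAdd 1) (hex : ∀ g, π g = 1 ↔ g ∈ α.range) (g : G)
    (i : ZMod M) :
    g⁻¹ * α (ofAdd i) * g = α (ofAdd ((r : ZMod M) ^ (toAdd (π g)).val * i)) := by
  set n := (toAdd (π g)).val with hn
  have h1 : π ((b ^ n)⁻¹ * g) = 1 := by
    rw [map_mul, map_inv, map_pow, hb, ← ofAdd_nsmul, inv_mul_eq_one]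
    apply Multiplicative.toAdd.injective
    simp [hn]
  obtain ⟨j, hj⟩ := (hex _).1 h1
  have hg : g = b ^ n * α j := by rw [hj, mul_inv_cancel_left]
  rw [← hG.conj_pow_map hα, hg]
  have hcomm : (α j)⁻¹ * α (ofAdd ((r : ZMod M) ^ n * i)) * α j =
      α (ofAdd ((r : ZMod M) ^ n * i)) := by
    rw [← map_inv, ← map_mul, ← map_mul, mul_right_comm, inv_mul_cancel, one_mul]
  rw [← hG.conj_pow_map hα] at hcomm
  rw [← hcomm]
  group

end Metacyclic

/-- Since the kernel of `(ℤ/q^m)ˣ → (ℤ/q)ˣ` is a `q`-group, a nontrivial power of an element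
of order prime to `q` acts without fixed points on the nonzero elements of `ℤ/q^m`. -/
theorem isUnit_one_sub_pow {p q m n : ℕ} [hp : Fact p.Prime] [hq : Fact q.Prime] (hpq : p ≠ q)
    {r : ℤ} (hr : orderOf (r : ZMod (q ^ m)) = p ^ n) {k : ℕ} (hk : ¬ p ^ n ∣ k) :
    IsUnit (1 - (r : ZMod (q ^ m)) ^ k) := by
  have hcast : (1 - (r : ZMod (q ^ m)) ^ k) = ((1 - r ^ k : ℤ) : ZMod (q ^ m)) := by simp
  rw [hcast, ZMod.coe_int_isUnit_iff_isCoprime, Nat.cast_pow]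
  refine IsCoprime.pow_left ?_
  rw [(Nat.prime_iff_prime_int.1 hq.out).coprime_iff_not_dvd]
  intro hdvd
  apply hk
  rw [dvd_sub_comm] at hdvd
  have h1 : ((q : ℤ) ^ (m + 1)) ∣ (r ^ k) ^ q ^ m - 1 ^ q ^ m := dvd_sub_pow_of_dvd_sub hdvd m
  have h2 : (r : ZMod (q ^ m)) ^ (k * q ^ m) = 1 := by
    have h3 : (((q ^ m : ℕ)) : ℤ) ∣ r ^ (k * q ^ m) - 1 := by
      rw [one_pow, ← pow_mul] at h1
      exact (by rw [Nat.cast_pow]; exact (pow_dvd_pow _ (Nat.le_succ m)).trans h1)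
    rw [← ZMod.intCast_zmod_eq_zero_iff_dvd, Int.cast_sub, sub_eq_zero] at h3
    simpa using h3
  have h4 := orderOf_dvd_of_pow_eq_one h2
  rw [hr] at h4
  exact (Nat.Coprime.pow _ _ ((Nat.coprime_primes hp.out hq.out).2 hpq)).dvd_of_dvd_mul_right h4

/-- Outside `⟨a⟩`, the conjugacy classes are unions of cosets of `⟨a⟩`. -/
theorem IsMetacyclic.exists_conj_eq_mul {p q m n : ℕ} [Fact p.Prime] [Fact q.Prime] (hpq : p ≠ q)
    {r : ℤ} (hr : orderOf (r : ZMod (q ^ m)) = p ^ n) {G : Type*} [Group G] {a b : G}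
    (hG : IsMetacyclic G (q ^ m) (p ^ n) r a b)
    {α : Multiplicative (ZMod (q ^ m)) →* G} {π : G →* Multiplicative (ZMod (p ^ n))}
    (hα : α (ofAdd 1) = a) (hb : π b = ofAdd 1) (hex : ∀ g, π g = 1 ↔ g ∈ α.range)
    {g : G} (hg : π g ≠ 1) (i : Multiplicative (ZMod (q ^ m))) :
    ∃ h : G, h⁻¹ * g * h = g * α i := by
  have hk : ¬ p ^ n ∣ (toAdd (π g)).val := fun h => hg <| by
    have h0 := Nat.eq_zero_of_dvd_of_lt h (ZMod.val_lt _)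
    exact Multiplicative.toAdd.injective ((ZMod.val_eq_zero _).1 h0)
  obtain ⟨u, hu⟩ := isUnit_one_sub_pow hpq hr hk
  -- conjugating by `a ^ l` multiplies `g` by `a ^ ((1 - r ^ k) l)`
  set l : ZMod (q ^ m) := ↑u⁻¹ * toAdd i with hl
  refine ⟨α (ofAdd l), ?_⟩
  have h1 := hG.conj_map_of_map_eq hα hb hex g (-l)
  have h2 : (α (ofAdd l))⁻¹ * g = g * α (ofAdd ((r : ZMod (q ^ m)) ^ (toAdd (π g)).val * -l)) := by
    rw [← h1, ← map_inv, ← ofAdd_neg]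
    group
  rw [h2, mul_assoc, ← map_mul, ← ofAdd_add]
  congr 2
  apply Multiplicative.toAdd.injective
  rw [toAdd_ofAdd]
  calc (r : ZMod (q ^ m)) ^ (toAdd (π g)).val * -l + l
      = (1 - (r : ZMod (q ^ m)) ^ (toAdd (π g)).val) * l := by ring
    _ = toAdd i := by rw [← hu, hl, Units.mul_inv_cancel_left]

end MetacyclicGroup

/-! ### Idempotents of complex group algebras and group extensions -/

section ComplexIdempotents

open ZMod MonoidAlgebra
open Multiplicative (ofAdd toAdd)

/-- Minimality in terms of complex group algebra elements: the central idempotents of `F G` are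
the idempotents of `ℂ G` whose coefficients form a class function with values in the image
of `F`. -/
theorem hasMinimalNumSimpleComponents_iff_complex (F G : Type*) [Field F] [CharZero F] [Group G]
    [Finite G] (ι : F →ₐ[ℚ] ℂ) :
    HasMinimalNumSimpleComponents F G ↔
      ∀ e : MonoidAlgebra ℂ G, e * e = e → (∀ h g, e.coeff (h⁻¹ * g * h) = e.coeff g) →
        (∀ g, e.coeff g ∈ ι.fieldRange) → ∀ g, e.coeff g ∈ (⊥ : IntermediateField ℚ ℂ) := by
  have hinj : Function.Injective (mapRingHom G (ι : F →+* ℂ)) :=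
    map_injective _ (ι : F →+* ℂ).injective
  rw [hasMinimalNumSimpleComponents_iff]
  constructor
  · intro h e he hc hF g
    have hmem : e ∈ Set.range (map (M := G) ((ι : F →+* ℂ) : F →+ ℂ)) := by
      rw [range_map]
      exact hF
    obtain ⟨e₀, rfl⟩ := hmem
    have h1 : e₀ ∈ centralIdempotents (MonoidAlgebra F G) := by
      refine ⟨hinj ?_, mem_center_iff_coeff_conj.2 fun h g => ι.injective ?_⟩
      · rw [map_mul]
        exact he
      · simpa using hc h g
    obtain ⟨c, hc⟩ := h e₀ h1 g
    rw [IntermediateField.mem_bot]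
    exact ⟨c, by simp [← hc]⟩
  · intro h e he g
    have hc := mem_center_iff_coeff_conj.1 he.2
    have := h (mapRingHom G (ι : F →+* ℂ) e) (by rw [← map_mul, he.1])
      (fun h g => by simp [hc h g]) (fun g => ⟨e.coeff g, by simp⟩) g
    obtain ⟨c, hc⟩ := IntermediateField.mem_bot.1 this
    refine ⟨c, ι.injective ?_⟩
    change ι _ = ι _
    simpa using hc

section Extension

variable {A G C : Type*} [CommGroup A] [Group G] [Group C]
  {α : A →* G} {π : G →* C}

/-- The fibres of `π` are the cosets of the image of `α`. -/
theorem sum_fiber_eq_sum_coset [Fintype A] [Fintype G] [DecidableEq C] {X : Type*}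
    [AddCommMonoid X] (hα : Function.Injective α)
    (hex : ∀ g, π g = 1 ↔ g ∈ α.range) (f : G → X) (g : G) :
    ∑ h with π h = π g, f h = ∑ i, f (g * α i) := by
  symm
  refine Finset.sum_bij (fun i _ => g * α i) ?_ ?_ ?_ fun _ _ => rfl
  · intro i _
    have : π (α i) = 1 := (hex _).2 ⟨i, rfl⟩
    simp [this]
  · intro i _ j _ h
    exact hα (mul_left_cancel h)
  · intro h hh
    have h1 : π (g⁻¹ * h) = 1 := by
      rw [map_mul, map_inv, (Finset.mem_filter.1 hh).2, inv_mul_cancel]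
    obtain ⟨i, hi⟩ := (hex _).1 h1
    exact ⟨i, Finset.mem_univ _, by rw [hi, mul_inv_cancel_left]⟩

variable [Finite G]

theorem coeff_mapDomainRingHom_eq_sum [Fintype A] (hα : Function.Injective α)
    (hex : ∀ g, π g = 1 ↔ g ∈ α.range) (x : MonoidAlgebra ℂ G) (g : G) :
    (mapDomainRingHom ℂ π x).coeff (π g) = ∑ i, x.coeff (g * α i) := by
  classical
  have := Fintype.ofFinite G
  rw [← sum_fiber_eq_sum_coset hα hex]
  change (Finsupp.mapDomain π x.coeff) (π g) = _
  rw [Finsupp.mapDomain, Finsupp.sum_fintype _ _ (by simp), Finsupp.finsetSum_apply,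
    Finset.sum_filter]
  exact Finset.sum_congr rfl fun h _ => Finsupp.single_apply

/-- Pulling back an idempotent along a surjection with kernel `A`, and dividing by the order of
`A`, gives an idempotent. -/
theorem mul_self_of_coeff_eq_comp [Finite A] [Finite C] (hα : Function.Injective α)
    (hπ : Function.Surjective π)
    (hex : ∀ g, π g = 1 ↔ g ∈ α.range) {y : MonoidAlgebra ℂ C} (hy : y * y = y)
    {e : MonoidAlgebra ℂ G} (he : ∀ g, e.coeff g = (Nat.card A : ℂ)⁻¹ * y.coeff (π g)) :
    e * e = e := by
  classical
  have := Fintype.ofFinite G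
  have := Fintype.ofFinite C
  have := Fintype.ofFinite A
  have hA : (Nat.card A : ℂ) ≠ 0 := by exact_mod_cast Nat.card_pos.ne'
  refine coeff_injective (Finsupp.ext fun g => ?_)
  have hy' := congrArg (fun y => y.coeff (π g)) hy
  simp only [coeff_mul_eq_sum] at hy'
  rw [coeff_mul_eq_sum, he, ← hy', ← Finset.sum_fiberwise Finset.univ π, Finset.mul_sum]
  refine Finset.sum_congr rfl fun c _ => ?_
  obtain ⟨h, rfl⟩ := hπ c
  rw [sum_fiber_eq_sum_coset hα hex]
  have h1 : ∀ i, π (α i) = 1 := fun i => (hex _).2 ⟨i, rfl⟩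
  simp only [he, map_mul, map_inv, h1, mul_one, Finset.sum_const, Finset.card_univ,
    ← Nat.card_eq_fintype_card, nsmul_eq_mul]
  field_simp

/-- Averaging over the normal subgroup `A` splits off from an idempotent class function the part
that is constant on the cosets of `A`; the remainder is again idempotent. -/
theorem exists_mul_self_coeff_eq_sub_average [Fintype A] (α : A →* G)
    {e : MonoidAlgebra ℂ G} (he : e * e = e) (hc : e ∈ Set.center (MonoidAlgebra ℂ G)) :
    ∃ e' : MonoidAlgebra ℂ G, e' * e' = e' ∧
      ∀ g, e'.coeff g = e.coeff g - (Nat.card A : ℂ)⁻¹ * ∑ i, e.coeff (g * α i) := by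
  have hA : (Nat.card A : ℂ) ≠ 0 := by exact_mod_cast Nat.card_pos.ne'
  set s : MonoidAlgebra ℂ G := ∑ i, of ℂ G (α i) with hs
  have hsi : ∀ j, of ℂ G (α j) * s = s := fun j => by
    rw [hs, Finset.mul_sum]
    exact Fintype.sum_equiv (Equiv.mulLeft j) _ _ fun i => by simp
  have hss : s * s = (Nat.card A : ℂ) • s := by
    nth_rw 1 [hs]
    rw [Finset.sum_mul]
    simp only [hsi, Finset.sum_const, Finset.card_univ, ← Nat.card_eq_fintype_card]
    rw [Nat.cast_smul_eq_nsmul]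
  set ε : MonoidAlgebra ℂ G := (Nat.card A : ℂ)⁻¹ • s with hε
  have hεε : ε * ε = ε := by
    rw [hε, smul_mul_smul_comm, hss, smul_smul, mul_assoc, inv_mul_cancel₀ hA, mul_one]
  have hcomm : e * ε = ε * e := hc.comm ε
  refine ⟨e - e * ε, ?_, fun g => ?_⟩
  · have h1 : e * ε * e = e * ε := by rw [mul_assoc, ← hcomm, ← mul_assoc, he]
    have h2 : e * (e * ε) = e * ε := by rw [← mul_assoc, he]
    have h3 : e * ε * (e * ε) = e * ε := by rw [← mul_assoc, h1, mul_assoc, hεε]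
    rw [sub_mul, mul_sub, mul_sub, he, h1, h2, h3]
    abel
  · have h1 : (e * ε).coeff g = (Nat.card A : ℂ)⁻¹ * ∑ i, e.coeff (g * α i) := by
      rw [hε, mul_smul_comm, coeff_smul_apply, smul_eq_mul, hs, Finset.mul_sum, coeff_sum,
        Finsupp.finsetSum_apply]
      congr 1
      refine Fintype.sum_equiv (Equiv.inv A) _ _ fun i => ?_
      rw [coeff_mul_of]
      simp
    rw [coeff_sub, Finsupp.sub_apply, h1]

end Extension

end ComplexIdempotents

/-! ### Rationality of central idempotents of metacyclic groups -/

section CentralIdempotents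

open ZMod MonoidAlgebra
open Multiplicative (ofAdd toAdd)

theorem isUnit_intCast_of_orderOf_eq {M d : ℕ} (hd : d ≠ 0) {r : ℤ}
    (hr : orderOf (r : ZMod M) = d) : IsUnit (r : ZMod M) :=
  IsUnit.of_pow_eq_one (n := d) (hr ▸ pow_orderOf_eq_one _) hd

theorem coeff_mem_adjoin_of_mul_self {k : ℕ} [NeZero k]
    {x : MonoidAlgebra ℂ (Multiplicative (ZMod k))} (hx : x * x = x)
    (i : Multiplicative (ZMod k)) : x.coeff i ∈ ℚ⟮cZeta k⟯ := by
  obtain ⟨S, hS⟩ := (mul_self_eq_iff_exists_finset x).1 hx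
  rw [← ofAdd_toAdd i, hS]
  exact mul_mem (inv_mem (natCast_mem _ _)) (sum_mem fun j _ => stdAddChar_mem_adjoin_cZeta k _)

/-- A coefficient of an idempotent that does not change under `i ↦ r i` is fixed by `ζ ↦ ζ ^ r`. -/
theorem coeff_mem_cyclotomicFixedField_of_mul_self {k : ℕ} [NeZero k]
    {x : MonoidAlgebra ℂ (Multiplicative (ZMod k))} (hx : x * x = x) {r : ℤ} {i : ZMod k}
    (hi : x.coeff (ofAdd ((r : ZMod k) * i)) = x.coeff (ofAdd i)) :
    x.coeff (ofAdd i) ∈ cyclotomicFixedField k r := by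
  obtain ⟨S, hS⟩ := (mul_self_eq_iff_exists_finset x).1 hx
  have hk : (k : ℂ)⁻¹ ≠ 0 := inv_ne_zero (by exact_mod_cast NeZero.ne k)
  rw [hS, hS] at hi
  rw [hS]
  exact mul_mem (inv_mem (natCast_mem _ _))
    (sum_stdAddChar_mem_cyclotomicFixedField r S i (mul_left_cancel₀ hk hi))

theorem exists_mul_self_coeff_eq {k : ℕ} [NeZero k] (S : Finset (ZMod k)) :
    ∃ x : MonoidAlgebra ℂ (Multiplicative (ZMod k)), x * x = x ∧
      ∀ i, x.coeff (ofAdd i) = (k : ℂ)⁻¹ * ∑ j ∈ S, stdAddChar (j * i) := by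
  let x : MonoidAlgebra ℂ (Multiplicative (ZMod k)) := .ofCoeff <| Finsupp.equivFunOnFinite.symm
    fun i => (k : ℂ)⁻¹ * ∑ j ∈ S, stdAddChar (j * toAdd i)
  exact ⟨x, (mul_self_eq_iff_exists_finset x).2 ⟨S, fun i => rfl⟩, fun i => rfl⟩

theorem mem_of_inv_natCast_mul_mem {E : IntermediateField ℚ ℂ} {k : ℕ} [NeZero k] {x : ℂ}
    (h : (k : ℂ)⁻¹ * x ∈ E) : x ∈ E := by
  have hk : (k : ℂ) ≠ 0 := by exact_mod_cast NeZero.ne k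
  rw [← mul_inv_cancel_left₀ hk x]
  exact mul_mem (natCast_mem _ _) h

section

variable {p q m n : ℕ} [Fact p.Prime] [Fact q.Prime] {r : ℤ} {G : Type*} [Group G]
  {a b : G}

/-- Sufficiency of the two field conditions: an idempotent class function `e` with values in `K` is
rational. The sums of `e` over the cosets of `⟨a⟩` are coefficients of an idempotent of the group
algebra of `G ⧸ ⟨a⟩`. Subtracting the average over cosets leaves an idempotent of the group algebra
of `⟨a⟩`, which is invariant under conjugation by `b`. -/
theorem IsMetacyclic.coeff_rational (hpq : p ≠ q)
    (hr : orderOf (r : ZMod (q ^ m)) = p ^ n) [Finite G]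
    (hG : IsMetacyclic G (q ^ m) (p ^ n) r a b) (K : IntermediateField ℚ ℂ)
    (h₁ : ℚ⟮cZeta (p ^ n)⟯ ⊓ K = ⊥) (h₂ : cyclotomicFixedField (q ^ m) r ⊓ K = ⊥)
    {e : MonoidAlgebra ℂ G} (he : e * e = e) (hc : ∀ h g, e.coeff (h⁻¹ * g * h) = e.coeff g)
    (hK : ∀ g, e.coeff g ∈ K) (g : G) : e.coeff g ∈ (⊥ : IntermediateField ℚ ℂ) := by
  obtain ⟨α, π, hα, hα1, hb, hex⟩ := hG.exists_exact
  have hcoset : ∀ g, ∑ i, e.coeff (g * α i) ∈ (⊥ : IntermediateField ℚ ℂ) := fun g => by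
    rw [← h₁]
    refine IntermediateField.mem_inf.2 ⟨?_, sum_mem fun i _ => hK _⟩
    rw [← coeff_mapDomainRingHom_eq_sum hα hex]
    exact coeff_mem_adjoin_of_mul_self (by rw [← map_mul, he]) _
  have hcard : Nat.card (Multiplicative (ZMod (q ^ m))) = q ^ m :=
    (Nat.card_congr Multiplicative.toAdd).trans (Nat.card_zmod _)
  have hconst : ∀ g, π g ≠ 1 →
      ∑ i, e.coeff (g * α i) = (Nat.card (Multiplicative (ZMod (q ^ m))) : ℂ) * e.coeff g := by
    intro g hg
    have : ∀ i, e.coeff (g * α i) = e.coeff g := fun i => by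
      obtain ⟨h, hh⟩ := hG.exists_conj_eq_mul hpq hr hα1 hb hex hg i
      rw [← hh, hc]
    simp [this]
  have h0 : (Nat.card (Multiplicative (ZMod (q ^ m))) : ℂ) ≠ 0 := by
    exact_mod_cast Nat.card_pos.ne'
  -- the part of `e` that is not constant on cosets is supported on `⟨a⟩`
  obtain ⟨e', he', hcoeff⟩ :=
    exists_mul_self_coeff_eq_sub_average α he (mem_center_iff_coeff_conj.2 hc)
  have hsupp : ↑e'.coeff.support ⊆ Set.range α := by
    intro g hg
    by_contra hgα
    refine Finsupp.mem_support_iff.1 hg ?_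
    rw [hcoeff, hconst g fun h => hgα ((hex g).1 h), inv_mul_cancel_left₀ h0, sub_self]
  set z := e'.comapDomain α hα with hz
  have hzmap : mapDomainRingHom ℂ α z = e' := mapDomain_comapDomain hsupp hα
  have hzz : z * z = z := mapDomain_injective hα <| by
    change mapDomainRingHom ℂ α _ = mapDomainRingHom ℂ α _
    rw [map_mul, hzmap, he']
  have hzc : ∀ i, z.coeff i = e'.coeff (α i) := fun i => rfl
  have hsub : e.coeff g = e'.coeff g +
      (Nat.card (Multiplicative (ZMod (q ^ m))) : ℂ)⁻¹ * ∑ i, e.coeff (g * α i) := by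
    rw [hcoeff, sub_add_cancel]
  rw [hsub]
  refine add_mem ?_ (mul_mem (inv_mem (natCast_mem _ _)) (hcoset g))
  by_cases hg : π g = 1
  · obtain ⟨i, rfl⟩ := (hex g).1 hg
    rw [← h₂]
    refine IntermediateField.mem_inf.2 ⟨?_, ?_⟩
    · rw [← hzc, ← ofAdd_toAdd i]
      refine coeff_mem_cyclotomicFixedField_of_mul_self hzz ?_
      have hfib : ∀ j, ∑ i, e.coeff (α j * α i) = ∑ i, e.coeff (α i) := fun j =>
        Fintype.sum_equiv (Equiv.mulLeft j) _ _ fun i => by simp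
      rw [hzc, hzc, hcoeff, hcoeff, hfib, hfib, ← hG.conj_map hα1, hc]
    · rw [hcoeff]
      exact sub_mem (hK _) (mul_mem (inv_mem (natCast_mem _ _)) (sum_mem fun i _ => hK _))
  · rw [hcoeff, hconst g hg, inv_mul_cancel_left₀ h0, sub_self]
    exact zero_mem _

/-- Necessity of the condition on `ℚ(ζ_{p^n})`, tested on the idempotents inflated from
`G ⧸ ⟨a⟩`. -/
theorem IsMetacyclic.adjoin_inf_eq_bot [Finite G] (hG : IsMetacyclic G (q ^ m) (p ^ n) r a b)
    (K : IntermediateField ℚ ℂ)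
    (H : ∀ e : MonoidAlgebra ℂ G, e * e = e → (∀ h g, e.coeff (h⁻¹ * g * h) = e.coeff g) →
        (∀ g, e.coeff g ∈ K) → ∀ g, e.coeff g ∈ (⊥ : IntermediateField ℚ ℂ)) :
    ℚ⟮cZeta (p ^ n)⟯ ⊓ K = ⊥ := by
  obtain ⟨α, π, hα, hα1, hb, hex⟩ := hG.exists_exact
  have hπ : Function.Surjective π := fun c => by
    refine ⟨b ^ (toAdd c).val, ?_⟩
    rw [map_pow, hb, ← ofAdd_nsmul]
    apply Multiplicative.toAdd.injective
    simp
  obtain ⟨S, hS, hbot, -⟩ := exists_finset_sum_stdAddChar (p ^ n) (ℚ⟮cZeta (p ^ n)⟯ ⊓ K)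
    inf_le_left
  obtain ⟨y, hy, hyS⟩ := exists_mul_self_coeff_eq S
  let e : MonoidAlgebra ℂ G := .ofCoeff <| Finsupp.equivFunOnFinite.symm
    fun g => (Nat.card (Multiplicative (ZMod (q ^ m))) : ℂ)⁻¹ * y.coeff (π g)
  have hecoeff : ∀ g, e.coeff g =
    (Nat.card (Multiplicative (ZMod (q ^ m))) : ℂ)⁻¹ * y.coeff (π g) := fun g => rfl
  have hyK : ∀ c, y.coeff c ∈ K := fun c => by
    rw [← ofAdd_toAdd c, hyS]
    exact mul_mem (inv_mem (natCast_mem _ _)) (IntermediateField.mem_inf.1 (hS _)).2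
  refine hbot fun i => ?_
  obtain ⟨g, hg⟩ := hπ (ofAdd i)
  have h1 := H e (mul_self_of_coeff_eq_comp hα hπ hex hy hecoeff)
    (fun h g => by
      have : π (h⁻¹ * g * h) = π g := by
        rw [map_mul, map_mul, map_inv, inv_mul_cancel_comm]
      rw [hecoeff, hecoeff, this])
    (fun g => by
      rw [hecoeff]
      exact mul_mem (inv_mem (natCast_mem _ _)) (hyK _)) g
  rw [hecoeff, hg, hyS] at h1
  have : NeZero (Nat.card (Multiplicative (ZMod (q ^ m)))) := ⟨Nat.card_pos.ne'⟩
  exact mem_of_inv_natCast_mul_mem (mem_of_inv_natCast_mul_mem h1)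

/-- Necessity of the condition on the fixed field, tested on idempotents supported on `⟨a⟩`: the
invariance of the character sums under `i ↦ r i` makes them central in the group algebra of
`G`. -/
theorem IsMetacyclic.cyclotomicFixedField_inf_eq_bot [Finite G]
    (hr : orderOf (r : ZMod (q ^ m)) = p ^ n) (hG : IsMetacyclic G (q ^ m) (p ^ n) r a b)
    (K : IntermediateField ℚ ℂ)
    (H : ∀ e : MonoidAlgebra ℂ G, e * e = e → (∀ h g, e.coeff (h⁻¹ * g * h) = e.coeff g) →
        (∀ g, e.coeff g ∈ K) → ∀ g, e.coeff g ∈ (⊥ : IntermediateField ℚ ℂ)) :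
    cyclotomicFixedField (q ^ m) r ⊓ K = ⊥ := by
  obtain ⟨α, π, hα, hα1, hb, hex⟩ := hG.exists_exact
  obtain ⟨S, hS, hbot, hinv⟩ := exists_finset_sum_stdAddChar (q ^ m)
    (cyclotomicFixedField (q ^ m) r ⊓ K) (inf_le_left.trans (cyclotomicFixedField_le _ _))
  replace hinv := hinv r (isUnit_intCast_of_orderOf_eq (NeZero.ne _) hr) inf_le_left
  obtain ⟨z, hz, hzS⟩ := exists_mul_self_coeff_eq S
  have hzr : ∀ i, z.coeff (ofAdd ((r : ZMod (q ^ m)) * i)) = z.coeff (ofAdd i) := fun i => by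
    rw [hzS, hzS, hinv]
  have hzrk : ∀ (k : ℕ) i,
      z.coeff (ofAdd ((r : ZMod (q ^ m)) ^ k * i)) = z.coeff (ofAdd i) := fun k => by
    induction k with
    | zero => simp
    | succ k ih =>
      intro i
      rw [pow_succ, mul_assoc, ih, hzr]
  set e := mapDomainRingHom ℂ α z with he
  have hin : ∀ i, e.coeff (α i) = z.coeff i := fun i => Finsupp.mapDomain_apply hα _ _
  have hout : ∀ g, g ∉ Set.range α → e.coeff g = 0 := fun g hg =>
    Finsupp.mapDomain_of_notMem_range _ _ hg
  have hcl : ∀ h g, e.coeff (h⁻¹ * g * h) = e.coeff g := fun h g => by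
    by_cases hg : π g = 1
    · obtain ⟨i, rfl⟩ := (hex g).1 hg
      rw [← ofAdd_toAdd i, hG.conj_map_of_map_eq hα1 hb hex, hin, hin, hzrk]
    · rw [hout g fun h => hg ((hex g).2 h), hout]
      intro h'
      apply hg
      rw [← (hex _).2 h', map_mul, map_mul, map_inv, inv_mul_cancel_comm]
  have hzK : ∀ i, z.coeff i ∈ K := fun i => by
    rw [← ofAdd_toAdd i, hzS]
    exact mul_mem (inv_mem (natCast_mem _ _)) (IntermediateField.mem_inf.1 (hS _)).2
  refine hbot fun i => ?_
  have h1 := H e (by rw [he, ← map_mul, hz]) hcl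
    (fun g => by
      by_cases hg : g ∈ Set.range α
      · obtain ⟨i, rfl⟩ := hg
        rw [hin]
        exact hzK i
      · rw [hout g hg]
        exact zero_mem _) (α (ofAdd i))
  rw [hin, hzS] at h1
  exact mem_of_inv_natCast_mul_mem h1

end

end CentralIdempotents

/-! ### Degrees of cyclotomic extensions -/

section Degrees

open Module

/-- A Galois extension and a finite extension meet trivially exactly when the degrees multiply. -/
theorem IntermediateField.inf_eq_bot_iff_finrank_sup {F₀ E : Type*} [Field F₀] [Field E]
    [Algebra F₀ E] (A B : IntermediateField F₀ E) [IsGalois F₀ A] [FiniteDimensional F₀ A]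
    [FiniteDimensional F₀ B] :
    A ⊓ B = ⊥ ↔ finrank F₀ ↥(A ⊔ B) = finrank F₀ A * finrank F₀ B := by
  rw [← IntermediateField.LinearDisjoint.iff_inf_eq_bot]
  exact ⟨fun h => h.finrank_sup, fun h => .of_finrank_sup h⟩

/-- `F₀(ζ)` and `F` meet in `F₀` exactly when adjoining `ζ` has the same degree over `F` as over
`F₀`: the compositum of the two inside `E` is the image of the cyclotomic extension `L` of `F`. -/
theorem adjoin_inf_fieldRange_eq_bot_iff_finrank {F₀ F L E : Type*} [Field F₀] [Field F] [Field L]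
    [Field E] [Algebra F₀ F] [Algebra F L] [Algebra F₀ L] [IsScalarTower F₀ F L] [Algebra F₀ E]
    [FiniteDimensional F₀ F] {k : ℕ} [NeZero k] [IsCyclotomicExtension {k} F L]
    {ζ : E} (hζ : IsPrimitiveRoot ζ k) (ι : F →ₐ[F₀] E) (w : L →ₐ[F₀] E)
    (hw : ∀ x, w (algebraMap F L x) = ι x) :
    F₀⟮ζ⟯ ⊓ ι.fieldRange = ⊥ ↔ finrank F L = finrank F₀ F₀⟮ζ⟯ := by
  have hcyc : IsCyclotomicExtension {k} F₀ F₀⟮ζ⟯ := isCyclotomicExtension_adjoin_simple hζ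
  have : FiniteDimensional F₀ F₀⟮ζ⟯ := IsCyclotomicExtension.finiteDimensional {k} F₀ _
  have : IsGalois F₀ F₀⟮ζ⟯ := IsCyclotomicExtension.isGalois {k} F₀ _
  have : FiniteDimensional F₀ ι.fieldRange :=
    (AlgEquiv.ofInjectiveField ι).toLinearEquiv.finiteDimensional
  have hsup : F₀⟮ζ⟯ ⊔ ι.fieldRange = w.fieldRange := by
    apply le_antisymm
    · refine sup_le ?_ ?_
      · rw [IntermediateField.adjoin_simple_le_iff]
        have hz := (IsCyclotomicExtension.zeta_spec k F L).map_of_injective (f := w) w.injective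
        obtain ⟨i, -, hi⟩ := hz.eq_pow_of_pow_eq_one hζ.pow_eq_one
        exact ⟨IsCyclotomicExtension.zeta k F L ^ i, by simpa using hi⟩
      · rintro _ ⟨x, rfl⟩
        exact ⟨algebraMap F L x, hw x⟩
    · rintro _ ⟨x, rfl⟩
      have hx := IsCyclotomicExtension.adjoin_roots (S := {k}) (A := F) x
      change w x ∈ _
      induction hx using Algebra.adjoin_induction with
      | mem x hx =>
        obtain ⟨_, hk, -, hx⟩ := hx
        rw [Set.mem_singleton_iff.1 hk] at hx
        obtain ⟨i, -, hi⟩ := hζ.eq_pow_of_pow_eq_one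
          (show w x ^ k = 1 by rw [← map_pow, hx, map_one])
        rw [← hi]
        exact pow_mem (SetLike.le_def.1 le_sup_left
          (IntermediateField.mem_adjoin_simple_self F₀ ζ)) i
      | algebraMap x =>
        rw [hw]
        exact SetLike.le_def.1 le_sup_right ⟨x, rfl⟩
      | add x y _ _ hx hy => rw [map_add]; exact add_mem hx hy
      | mul x y _ _ hx hy => rw [map_mul]; exact mul_mem hx hy
  have h1 : finrank F₀ w.fieldRange = finrank F₀ F * finrank F L := by
    rw [Module.finrank_mul_finrank]
    exact (AlgEquiv.ofInjectiveField w).toLinearEquiv.finrank_eq.symm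
  have h2 : finrank F₀ ι.fieldRange = finrank F₀ F :=
    (AlgEquiv.ofInjectiveField ι).toLinearEquiv.finrank_eq.symm
  rw [IntermediateField.inf_eq_bot_iff_finrank_sup, hsup, h1, h2, mul_comm]
  exact mul_left_inj' finrank_pos.ne'

theorem adjoin_cZeta_inf_eq_bot_iff (F : Type*) [Field F] [NumberField F] (ι : F →ₐ[ℚ] ℂ)
    (k : ℕ) [NeZero k] :
    ℚ⟮cZeta k⟯ ⊓ ι.fieldRange = ⊥ ↔ Nat.card (cyclotomicImage k F) = Nat.totient k := by
  have hz := isPrimitiveRoot_cZeta k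
  have hint : IsIntegral ℚ (cZeta k) := (hz.isIntegral (NeZero.pos k)).tower_top
  have hcard : Nat.card (cyclotomicImage k F) = finrank F (CyclotomicField k F) := by
    have : IsGalois F (CyclotomicField k F) := IsCyclotomicExtension.isGalois {k} F _
    have : FiniteDimensional F (CyclotomicField k F) :=
      IsCyclotomicExtension.finiteDimensional {k} F _
    rw [← IsGalois.card_aut_eq_finrank]
    exact (Nat.card_congr (MonoidHom.ofInjective (IsPrimitiveRoot.autToPow_injective F
      (IsCyclotomicExtension.zeta_spec k F (CyclotomicField k F)))).toEquiv).symm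
  have htot : finrank ℚ ℚ⟮cZeta k⟯ = Nat.totient k := by
    have h := IntermediateField.adjoin.finrank hint
    rw [← Polynomial.cyclotomic_eq_minpoly_rat hz (NeZero.pos k),
      Polynomial.natDegree_cyclotomic] at h
    rw [← h]
  let _ : Algebra F ℂ := ι.toRingHom.toAlgebra
  have : FiniteDimensional F (CyclotomicField k F) :=
    IsCyclotomicExtension.finiteDimensional {k} F _
  have w : CyclotomicField k F →ₐ[F] ℂ := IsAlgClosed.lift
  rw [hcard, ← htot]
  exact adjoin_inf_fieldRange_eq_bot_iff_finrank (L := CyclotomicField k F) hz ι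
    (RingHom.toRatAlgHom (w : CyclotomicField k F →+* ℂ)) w.commutes

end Degrees

theorem mainTheorem11 (F : Type*) [Field F] [NumberField F] (ι : F →ₐ[ℚ] ℂ)
    (p q m n : ℕ) [Fact p.Prime] [Fact q.Prime] (hpq : p ≠ q) (r : ℤ)
    (hr : orderOf (r : ZMod (q ^ m)) = p ^ n)
    (G : Type*) [Group G] (a b : G) (hG : IsMetacyclic G (q ^ m) (p ^ n) r a b) :
    (HasMinimalNumSimpleComponents F G ↔
      ℚ⟮cZeta (p ^ n)⟯ ⊓ ι.fieldRange = ⊥ ∧ cyclotomicFixedField (q ^ m) r ⊓ ι.fieldRange = ⊥) ∧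
    (ℚ⟮cZeta (p ^ n)⟯ ⊓ ι.fieldRange = ⊥ ↔
      Nat.card (cyclotomicImage (p ^ n) F) = Nat.totient (p ^ n)) := by
  refine ⟨?_, adjoin_cZeta_inf_eq_bot_iff F ι (p ^ n)⟩
  have : Finite G := Nat.finite_of_card_ne_zero <| by
    rw [hG.card]
    exact mul_ne_zero (NeZero.ne _) (NeZero.ne _)
  rw [hasMinimalNumSimpleComponents_iff_complex F G ι]
  constructor
  · exact fun H => ⟨hG.adjoin_inf_eq_bot _ H, hG.cyclotomicFixedField_inf_eq_bot hr _ H⟩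
  · rintro ⟨h₁, h₂⟩ e he hc hK
    exact hG.coeff_rational hpq hr _ h₁ h₂ he hc hK
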